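/- For $A\ge 0$ let $E_A$ be the set of locally integrable functions $f:[0,\infty)\to\mathbb{R}$ for which there is a constant $K>0$ with $|f(t)|\le Ke^{At}$ for all $t\ge 0$, and let $E=\bigcup_{A\ge 0}E_A$. For $n\in\mathbb{N}$ and $k\in\mathbb{Z}$ put $s_{n,k}(x)=\frac{(nx)^k}{k!}e^{-nx}$ if $k\ge 0$ and $s_{n,k}(x)=0$ if $k<0$. For $j\in\mathbb{Z}$, $f\in E_A$ and $n>A$ define $$(S_{n,j}f)(x)=f(0)\sum_{k=0}^{j-1}s_{n,k}(x)+\sum_{k=j}^{\infty}s_{n,k}(x)\,n\int_0^\infty s_{n,k-j}(t)f(t)\,dt,$$ where the first sum is zero if $j\le 0$. For an integer $k\ge 1$ let $$(\mathcal{D}_j^{2k}f)(x)=x^j\,\frac{d^k}{dx^k}\Bigl(x^{k-j}f^{(k)}(x)\Bigr).$$ **Theorem.** Let $j\in\mathbb{Z}$, let $q\ge 1$ be an integer, let $x>0$, and let $f\in E$ be such that the derivative $f^{(2q)}(x)$ exists (that is, $f^{(2q-1)}$ exists in a neighbourhood of $x$ and is differentiable at $x$). Then $(S_{n,j}f)(x)$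 is well defined for all $n>A$ whenever $A\ge 0$ and $f\in E_A$ (all the integrals and the series in its definition converge absolutely), and $$(S_{n,j}f)(x)=f(x)+\sum_{k=1}^{q}\frac{1}{k!\,n^k}\,(\mathcal{D}_j^{2k}f)(x)+o(n^{-q})\qquad(n\to\infty,\ n\in\mathbb{N}).$$ -/

import Mathlib

open MeasureTheory Filter Topology Asymptotics

noncomputable section

namespace SzaszDurrmeyer

/-- The space `E_A`: locally integrable functions on `[0, ∞)` with `|f t| ≤ K e^{A t}` there for
some positive constant `K`. A function on `[0, ∞)` is represented by a function `ℝ → ℝ` of which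
only the restriction to `[0, ∞)` matters. -/
def expGrowth (A : ℝ) : Set (ℝ → ℝ) :=
  {f | LocallyIntegrableOn f (Set.Ici 0) volume ∧
    ∃ K : ℝ, 0 < K ∧ ∀ t : ℝ, 0 ≤ t → |f t| ≤ K * Real.exp (A * t)}

/-- The space `E`, the union of all `E_A` with `A ≥ 0`. -/
def expGrowthSpace : Set (ℝ → ℝ) :=
  {f | ∃ A : ℝ, 0 ≤ A ∧ f ∈ expGrowth A}

/-- The basis function `s_{n,k}(x) = (n x)^k / k! * e^{-n x}` for `k ≥ 0`, and `0` for `k < 0`. -/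
def basis (n : ℝ) (k : ℤ) (x : ℝ) : ℝ :=
  if k < 0 then 0
  else (n * x) ^ k.toNat / (k.toNat.factorial : ℝ) * Real.exp (-(n * x))

/-- The term with index `k = j + m` of the series that defines `(S_{n,j} f)(x)`, namely
`s_{n,k}(x) * n * ∫_0^∞ s_{n,k-j}(t) f(t) dt`. -/
def seriesTerm (n : ℝ) (j : ℤ) (f : ℝ → ℝ) (x : ℝ) (m : ℕ) : ℝ :=
  basis n (j + m) x * (n * ∫ t in Set.Ioi (0 : ℝ), basis n m t * f t)

/-- `(S_{n,j} f)(x) = f(0) ∑_{k=0}^{j-1} s_{n,k}(x)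
  + ∑_{k=j}^∞ s_{n,k}(x) n ∫_0^∞ s_{n,k-j}(t) f(t) dt`; the second sum runs over `k = j + m`,
`m = 0, 1, 2, …`. The first one is empty for `j ≤ 0`. -/
def operator (n : ℝ) (j : ℤ) (f : ℝ → ℝ) (x : ℝ) : ℝ :=
  f 0 * ∑ k ∈ Finset.Ico (0 : ℤ) j, basis n k x + ∑' m : ℕ, seriesTerm n j f x m

/-- All integrals and the series in the definition of `(S_{n,j} f)(x)` converge (absolutely). -/
def OperatorDefined (n : ℝ) (j : ℤ) (f : ℝ → ℝ) (x : ℝ) : Prop :=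
  (∀ m : ℕ, IntegrableOn (fun t => basis n m t * f t) (Set.Ioi (0 : ℝ)) volume) ∧
    Summable (seriesTerm n j f x)

/-- The (classical, pointwise) derivative `f^{(m)}(x)` exists: for `m + 1` this means that
`f^{(m)}` exists in a neighbourhood of `x` and is differentiable at `x`. -/
def DerivExists (f : ℝ → ℝ) : ℕ → ℝ → Prop
  | 0, _ => True
  | m + 1, x => (∀ᶠ t in 𝓝 x, DerivExists f m t) ∧ DifferentiableAt ℝ (iteratedDeriv m f) x

/-- The differential operator `𝒟_j^{2k} f = e_j D^k (e_{k-j} D^k f)`, where `e_r(t) = t^r`. -/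
def diffOp (j : ℤ) (k : ℕ) (f : ℝ → ℝ) (x : ℝ) : ℝ :=
  x ^ j * iteratedDeriv k (fun t => t ^ ((k : ℤ) - j) * iteratedDeriv k f t) x

end SzaszDurrmeyer

end

/-!
The operator is, apart from the value at `0`, integration against a nonnegative kernel, and this
kernel is a mixture of gamma densities with Poisson weights. The expansion follows from three
observations.

*Localization.* The integral part of the operator maps `t ↦ e^{a t}`, `a < n`, to an explicit
function which, with `ρ = n / (n - a)`, is at most `ρ^{1-j} e^{n x (ρ - 1)}`. For `a = ± √n` this
shows that the image of `t ↦ e^{± √n (t - x)}` stays bounded at `x` as `n → ∞`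
(`tendsto_exp_moment_bound`). Near `x` one has `n^q |t - x|^{2q} / (2q)! ≤ e^{√n |t - x|}`, and for
`|t - x| ≥ δ` the function `e^{A t}` is at most a constant times `e^{-δ √n} e^{√n |t - x|}`. So a
function of exponential growth that is `o((t - x)^{2q})` at `x` is mapped to `o(n^{-q})`
(`tsum_seriesTerm_isLittleO`), and central moments are not needed.

*Monomials.* The image of `t^r` is computed from the factorial moments of the Poisson distribution
and Vandermonde's identity (`operator_pow`). It is `∑ k, 𝒟_j^{2k} t^r / (k! n^k)` up to finitely
many terms with exponentially small factors `s_{n,k}(x)`, `0 ≤ k < j`.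

*Taylor polynomial.* The value `(𝒟_j^{2k} f)(x)` is a linear combination of the derivatives of `f`
at `x` of orders `k, …, 2k` (`exists_diffOp_eq`), so for `k ≤ q` it does not change if `f` is
replaced by a polynomial `p` with the same derivatives at `x` up to the order `2q`. The difference
`f - p` is `o((t - x)^{2q})` by Taylor's formula with Peano remainder
(`sub_isLittleO_of_iteratedDeriv_eq`).
-/

namespace SzaszDurrmeyer

/-! ### Integrals and sums of the basis functions -/

theorem integrableOn_pow_mul_exp_neg_mul (m : ℕ) {b : ℝ} (hb : 0 < b) :
    IntegrableOn (fun t : ℝ => t ^ m * Real.exp (-(b * t))) (Set.Ioi 0) := by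
  have h := integrableOn_rpow_mul_exp_neg_mul_rpow (p := 1) (s := m) (b := b)
    (by have : (0 : ℝ) ≤ m := m.cast_nonneg
        linarith) one_pos hb
  refine h.congr_fun (fun t _ => ?_) measurableSet_Ioi
  simp

theorem integral_pow_mul_exp_neg_mul (m : ℕ) {b : ℝ} (hb : 0 < b) :
    ∫ t in Set.Ioi (0 : ℝ), t ^ m * Real.exp (-(b * t)) = m.factorial / b ^ (m + 1) := by
  have h := Real.integral_rpow_mul_exp_neg_mul_Ioi (a := (m : ℝ) + 1) (r := b)
    (by positivity) hb
  rw [Real.Gamma_nat_eq_factorial] at h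
  have h2 : (1 / b) ^ ((m : ℝ) + 1) = 1 / b ^ (m + 1) := by
    rw [← Nat.cast_succ, Real.rpow_natCast, one_div_pow]
  rw [h2] at h
  simp only [add_sub_cancel_right, Real.rpow_natCast] at h
  rw [h]
  ring

theorem basis_natCast (n : ℝ) (m : ℕ) (t : ℝ) :
    basis n m t = (n * t) ^ m / m.factorial * Real.exp (-(n * t)) := by
  simp [basis]

theorem basis_of_neg (n : ℝ) {k : ℤ} (hk : k < 0) (t : ℝ) : basis n k t = 0 := by
  simp [basis, hk]

theorem basis_nonneg {n : ℝ} (hn : 0 ≤ n) (k : ℤ) {t : ℝ} (ht : 0 ≤ t) : 0 ≤ basis n k t := by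
  unfold basis
  split_ifs
  · exact le_rfl
  · positivity

theorem continuous_basis (n : ℝ) (m : ℕ) : Continuous (basis n m) := by
  rw [show basis n m = _ from funext (basis_natCast n m)]
  fun_prop

theorem basis_mul_exp (n l : ℝ) (m : ℕ) (t : ℝ) :
    basis n m t * Real.exp (l * t) =
      n ^ m / m.factorial * (t ^ m * Real.exp (-((n - l) * t))) := by
  rw [basis_natCast, mul_pow, show -((n - l) * t) = -(n * t) + l * t by ring, Real.exp_add]
  ring

theorem basis_mul_pow (n : ℝ) (r m : ℕ) (t : ℝ) :
    basis n m t * t ^ r =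
      n ^ m / m.factorial * (t ^ (m + r) * Real.exp (-(n * t))) := by
  rw [basis_natCast, mul_pow, pow_add]
  ring

theorem integrableOn_basis_mul_exp {n l : ℝ} (h : l < n) (m : ℕ) :
    IntegrableOn (fun t => basis n m t * Real.exp (l * t)) (Set.Ioi 0) := by
  simp only [basis_mul_exp]
  exact (integrableOn_pow_mul_exp_neg_mul m (sub_pos.2 h)).const_mul _

theorem mul_integral_basis_mul_exp {n l : ℝ} (h : l < n) (m : ℕ) :
    n * ∫ t in Set.Ioi (0 : ℝ), basis n m t * Real.exp (l * t) = (n / (n - l)) ^ (m + 1) := by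
  simp only [basis_mul_exp]
  rw [integral_const_mul, integral_pow_mul_exp_neg_mul m (sub_pos.2 h), div_pow]
  have : (m.factorial : ℝ) ≠ 0 := by positivity
  have : n - l ≠ 0 := (sub_pos.2 h).ne'
  field_simp
  ring

theorem mul_integral_basis_mul_pow {n : ℝ} (hn : 0 < n) (r m : ℕ) :
    n * ∫ t in Set.Ioi (0 : ℝ), basis n m t * t ^ r =
      (descPochhammer ℝ r).eval ((m : ℝ) + r) / n ^ r := by
  simp only [basis_mul_pow]
  rw [integral_const_mul, integral_pow_mul_exp_neg_mul _ hn]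
  have h1 : (descPochhammer ℝ r).eval ((m : ℝ) + r) = ((m + r).descFactorial r : ℕ) := by
    rw [← Nat.cast_add, descPochhammer_eval_eq_descFactorial]
  have h2 : ((m.factorial : ℕ) : ℝ) * ((m + r).descFactorial r : ℕ) = ((m + r).factorial : ℕ) := by
    rw [← Nat.factorial_mul_descFactorial (show r ≤ m + r by omega)]
    push_cast
    simp
  rw [h1, ← h2]
  have : (m.factorial : ℝ) ≠ 0 := by positivity
  field_simp
  ring

/-- A family indexed by `ℤ` that vanishes at negative indices is summed over `ℕ`. -/
theorem hasSum_int_of_neg_eq_zero {h : ℤ → ℝ} (h0 : ∀ k < 0, h k = 0) {a : ℝ}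
    (ha : HasSum (fun k : ℕ => h k) a) : HasSum h a := by
  refine (Function.Injective.hasSum_iff (g := ((↑) : ℕ → ℤ)) Nat.cast_injective ?_).1 ha
  intro k hk
  refine h0 k (not_le.1 fun hk' => hk ⟨k.toNat, ?_⟩)
  simp [hk']

theorem hasSum_pow_div_factorial (y : ℝ) :
    HasSum (fun k : ℕ => y ^ k / k.factorial) (Real.exp y) := by
  rw [Real.exp_eq_exp_ℝ]
  exact NormedSpace.expSeries_div_hasSum_exp y

/-- The generating function of the Poisson distribution with mean `n x`. -/
theorem hasSum_basis_mul_zpow (n x r : ℝ) :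
    HasSum (fun k : ℤ => basis n k x * r ^ k) (Real.exp (n * x * (r - 1))) := by
  refine hasSum_int_of_neg_eq_zero (fun k hk => by simp [basis_of_neg n hk]) ?_
  have h := (hasSum_pow_div_factorial (n * x * r)).mul_right (Real.exp (-(n * x)))
  rw [← Real.exp_add] at h
  rw [show n * x * (r - 1) = n * x * r + -(n * x) by ring]
  refine Eq.subst (motive := fun F => HasSum F _) (funext fun k => Eq.symm ?_) h
  rw [basis_natCast, zpow_natCast, mul_pow (n * x)]
  ring

/-- The factorial moments of the Poisson distribution with mean `n x`. -/
theorem hasSum_basis_mul_descPochhammer (n x : ℝ) (i : ℕ) :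
    HasSum (fun k : ℤ => basis n k x * (descPochhammer ℝ i).eval (k : ℝ)) ((n * x) ^ i) := by
  refine hasSum_int_of_neg_eq_zero (fun k hk => by simp [basis_of_neg n hk]) ?_
  have h0 := ((hasSum_pow_div_factorial (n * x)).mul_right
    (Real.exp (-(n * x)))).mul_left ((n * x) ^ i)
  rw [← Real.exp_add, add_neg_cancel, Real.exp_zero, mul_one] at h0
  refine (Function.Injective.hasSum_iff (add_left_injective i) ?_).1 ?_
  · intro k hk
    have hk' : k < i := not_le.1 fun hk' => hk ⟨k - i, by simp [hk']⟩
    rw [Int.cast_natCast, descPochhammer_eval_eq_descFactorial, Nat.descFactorial_of_lt hk']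
    simp
  · refine Eq.subst (motive := fun F => HasSum F _) (funext fun k => Eq.symm ?_) h0
    simp only [Function.comp, Int.cast_natCast]
    rw [descPochhammer_eval_eq_descFactorial, basis_natCast,
      ← Nat.factorial_mul_descFactorial (show i ≤ k + i by omega), pow_add, Nat.add_sub_cancel]
    have h1 : (k.factorial : ℝ) ≠ 0 := by positivity
    have h2 : ((k + i).descFactorial i : ℝ) ≠ 0 := by
      have := Nat.descFactorial_pos.2 (show i ≤ k + i by omega)
      positivity
    push_cast
    field_simp

/-- Vandermonde's identity for falling factorials. -/
theorem descPochhammer_eval_add (r s : ℝ) (k : ℕ) :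
    (descPochhammer ℝ k).eval (r + s) = ∑ i ∈ Finset.range (k + 1),
      (k.choose i : ℝ) * ((descPochhammer ℝ (k - i)).eval r * (descPochhammer ℝ i).eval s) := by
  have key : ∀ (m : ℕ) (u : ℝ), (descPochhammer ℤ m).smeval u = (descPochhammer ℝ m).eval u := by
    intro m u
    rw [← descPochhammer_map (Int.castRingHom ℝ), Polynomial.eval_map, Polynomial.eval₂_eq_sum,
      Polynomial.smeval_eq_sum]
    simp [Polynomial.sum, Polynomial.smul_pow]
  have h := Ring.descPochhammer_smeval_add k (Commute.all s r)
  rw [key, add_comm s r] at h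
  rw [h, Finset.Nat.sum_antidiagonal_eq_sum_range_succ_mk]
  refine Finset.sum_congr rfl fun i _ => ?_
  simp only [key]
  ring_nf

/-- The sum over the indices `k ≥ j` of a family indexed by `ℤ` and vanishing at negative
indices. -/
theorem hasSum_int_shift {h : ℤ → ℝ} (h0 : ∀ k < 0, h k = 0) {a : ℝ} (ha : HasSum h a) (j : ℤ) :
    HasSum (fun m : ℕ => h (j + m)) (a - ∑ k ∈ Finset.Ico 0 j, h k) := by
  have h1 : HasSum (fun k => if k ∈ Finset.Ico 0 j then h k else 0)
      (∑ k ∈ Finset.Ico 0 j, h k) := by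
    rw [← Finset.sum_congr rfl fun k hk => if_pos (c := k ∈ Finset.Ico 0 j) (e := (0 : ℝ)) hk]
    exact hasSum_sum_of_ne_finset_zero fun k hk => if_neg hk
  have h2 := ha.sub h1
  have hinj : Function.Injective (fun m : ℕ => j + (m : ℤ)) := fun a b hab => by
    simpa using hab
  rw [← hinj.hasSum_iff] at h2
  · refine Eq.subst (motive := fun F => HasSum F _) (funext fun m => ?_) h2
    simp
  · intro k hk
    by_cases hk0 : k < 0
    · simp [h0 k hk0]
    · have : k < j := not_le.1 fun hjk => hk ⟨(k - j).toNat, by simp [hjk]⟩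
      simp [this, not_lt.1 hk0]

/-! ### The operator on functions of exponential growth -/

theorem hasSum_basis_mul_pow_succ (n x : ℝ) (j : ℤ) {r : ℝ} (hr : r ≠ 0) :
    HasSum (fun m : ℕ => basis n (j + m) x * r ^ (m + 1))
      (r ^ (1 - j) * (Real.exp (n * x * (r - 1)) -
        ∑ k ∈ Finset.Ico 0 j, basis n k x * r ^ k)) := by
  have h := (hasSum_int_shift (fun k hk => by simp [basis_of_neg n hk])
    (hasSum_basis_mul_zpow n x r) j).mul_left (r ^ (1 - j))
  refine Eq.subst (motive := fun F => HasSum F _) (funext fun m => ?_) h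
  have : r ^ (m + 1) = r ^ (1 - j) * r ^ (j + m) := by
    rw [← zpow_add₀ hr, ← zpow_natCast]
    congr 1
    push_cast
    ring
  rw [this]
  ring

theorem tsum_basis_mul_pow_succ_le {n x : ℝ} (hn : 0 ≤ n) (hx : 0 ≤ x) (j : ℤ) {r : ℝ}
    (hr : 0 < r) :
    ∑' m : ℕ, basis n (j + m) x * r ^ (m + 1) ≤
      r ^ (1 - j) * Real.exp (n * x * (r - 1)) := by
  rw [(hasSum_basis_mul_pow_succ n x j hr.ne').tsum_eq]
  have : 0 ≤ ∑ k ∈ Finset.Ico 0 j, basis n k x * r ^ k :=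
    Finset.sum_nonneg fun k _ => mul_nonneg (basis_nonneg hn k hx) (zpow_pos hr k).le
  gcongr
  linarith

theorem integrableOn_basis_mul {n a b C D : ℝ} (ha : a < n) (hb : b < n)
    {g : ℝ → ℝ} (hg : AEStronglyMeasurable g (volume.restrict (Set.Ioi 0)))
    (hgle : ∀ t > 0, |g t| ≤ C * Real.exp (a * t) + D * Real.exp (b * t)) (m : ℕ) :
    IntegrableOn (fun t => basis n m t * g t) (Set.Ioi 0) := by
  have hI := ((integrableOn_basis_mul_exp ha m).const_mul C).add
    ((integrableOn_basis_mul_exp hb m).const_mul D)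
  refine hI.norm.mono' ((continuous_basis n m).aestronglyMeasurable.mul hg) ?_
  refine (ae_restrict_iff' measurableSet_Ioi).2 (Eventually.of_forall fun t ht => ?_)
  have h1 := (hgle t ht).trans (le_abs_self _)
  have h2 : (C * (basis n m t * Real.exp (a * t)) + D * (basis n m t * Real.exp (b * t))) =
    basis n m t * (C * Real.exp (a * t) + D * Real.exp (b * t)) := by ring
  simp only [Pi.add_apply, Real.norm_eq_abs, abs_mul, h2]
  gcongr

/-- If `|g|` is at most a sum of two exponentials, its series is dominated by theirs, which are
explicit because `n ∫ s_{n,m}(t) e^{a t} dt = (n / (n - a))^{m + 1}`. -/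
theorem abs_seriesTerm_le {n a b C D : ℝ} (hn : 0 < n) (ha : a < n) (hb : b < n)
    {g : ℝ → ℝ} (hgle : ∀ t > 0, |g t| ≤ C * Real.exp (a * t) + D * Real.exp (b * t))
    (j : ℤ) {x : ℝ} (hx : 0 ≤ x) (m : ℕ) :
    |seriesTerm n j g x m| ≤ C * (basis n (j + m) x * (n / (n - a)) ^ (m + 1)) +
      D * (basis n (j + m) x * (n / (n - b)) ^ (m + 1)) := by
  have ia := (integrableOn_basis_mul_exp ha m).const_mul C
  have ib := (integrableOn_basis_mul_exp hb m).const_mul D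
  have hI : |∫ t in Set.Ioi (0 : ℝ), basis n m t * g t| ≤
      ∫ t in Set.Ioi (0 : ℝ), (C * (basis n m t * Real.exp (a * t)) +
        D * (basis n m t * Real.exp (b * t))) := by
    refine norm_integral_le_of_norm_le (f := fun t => basis n m t * g t) (ia.add ib) ?_
    refine (ae_restrict_iff' measurableSet_Ioi).2 (Eventually.of_forall fun t ht => ?_)
    have h0 := basis_nonneg hn.le m (le_of_lt ht)
    rw [Real.norm_eq_abs, abs_mul, abs_of_nonneg h0]
    calc _ ≤ basis n m t * (C * Real.exp (a * t) + D * Real.exp (b * t)) :=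
          mul_le_mul_of_nonneg_left (hgle t ht) h0
      _ = _ := by ring
  rw [integral_add ia ib, integral_const_mul, integral_const_mul] at hI
  have h0 := basis_nonneg hn.le (j + m) hx
  rw [seriesTerm, abs_mul, abs_mul, abs_of_nonneg h0, abs_of_pos hn,
    ← mul_integral_basis_mul_exp ha m, ← mul_integral_basis_mul_exp hb m]
  calc _ ≤ _ := mul_le_mul_of_nonneg_left (mul_le_mul_of_nonneg_left hI hn.le) h0
    _ = _ := by ring

theorem summable_basis_mul_pow_succ {n a : ℝ} (hn : 0 < n) (ha : a < n) (j : ℤ) (x : ℝ) :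
    Summable (fun m : ℕ => basis n (j + m) x * (n / (n - a)) ^ (m + 1)) :=
  (hasSum_basis_mul_pow_succ n x j (div_pos hn (sub_pos.2 ha)).ne').summable

theorem abs_tsum_seriesTerm_le {n a b C D : ℝ} (hn : 0 < n) (ha : a < n) (hb : b < n)
    (hC : 0 ≤ C) (hD : 0 ≤ D)
    {g : ℝ → ℝ} (hgle : ∀ t > 0, |g t| ≤ C * Real.exp (a * t) + D * Real.exp (b * t))
    (j : ℤ) {x : ℝ} (hx : 0 ≤ x) :
    |∑' m, seriesTerm n j g x m| ≤
      C * ((n / (n - a)) ^ (1 - j) * Real.exp (n * x * (n / (n - a) - 1))) +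
      D * ((n / (n - b)) ^ (1 - j) * Real.exp (n * x * (n / (n - b) - 1))) := by
  have sa := summable_basis_mul_pow_succ hn ha j x
  have sb := summable_basis_mul_pow_succ hn hb j x
  have ra : 0 < n / (n - a) := div_pos hn (sub_pos.2 ha)
  have rb : 0 < n / (n - b) := div_pos hn (sub_pos.2 hb)
  have hs := ((sa.mul_left C).add (sb.mul_left D)).hasSum
  refine (tsum_of_norm_bounded (f := seriesTerm n j g x) hs fun m =>
    abs_seriesTerm_le hn ha hb hgle j hx m).trans ?_
  rw [(sa.mul_left C).tsum_add (sb.mul_left D), tsum_mul_left, tsum_mul_left]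
  exact add_le_add
    (mul_le_mul_of_nonneg_left (tsum_basis_mul_pow_succ_le hn.le hx j ra) hC)
    (mul_le_mul_of_nonneg_left (tsum_basis_mul_pow_succ_le hn.le hx j rb) hD)

theorem aestronglyMeasurable_of_mem_expGrowth {A : ℝ} {f : ℝ → ℝ} (hf : f ∈ expGrowth A) :
    AEStronglyMeasurable f (volume.restrict (Set.Ioi 0)) :=
  hf.1.aestronglyMeasurable.mono_measure
    (Measure.restrict_mono Set.Ioi_subset_Ici_self le_rfl)

theorem operatorDefined_of_mem_expGrowth {A n : ℝ} {f : ℝ → ℝ} (hf : f ∈ expGrowth A)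
    (hn : 0 < n) (hA : A < n) (j : ℤ) {x : ℝ} (hx : 0 ≤ x) : OperatorDefined n j f x := by
  obtain ⟨K, _, hK⟩ := hf.2
  have hle : ∀ t > 0, |f t| ≤ K * Real.exp (A * t) + 0 * Real.exp (A * t) := fun t ht => by
    simpa using hK t (le_of_lt ht)
  have s := summable_basis_mul_pow_succ hn hA j x
  exact ⟨integrableOn_basis_mul hA hA (aestronglyMeasurable_of_mem_expGrowth hf) hle,
    Summable.of_norm_bounded ((s.mul_left K).add (s.mul_left 0))
      fun m => abs_seriesTerm_le hn hA hA hle j hx m⟩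

theorem seriesTerm_add_mul {n : ℝ} {j : ℤ} {f g : ℝ → ℝ} {x : ℝ} (hf : OperatorDefined n j f x)
    (hg : OperatorDefined n j g x) (c : ℝ) (m : ℕ) :
    seriesTerm n j (fun t => f t + c * g t) x m =
      seriesTerm n j f x m + c * seriesTerm n j g x m := by
  have h : ∫ t in Set.Ioi (0 : ℝ), basis n m t * (f t + c * g t) =
      (∫ t in Set.Ioi (0 : ℝ), basis n m t * f t) +
        c * ∫ t in Set.Ioi (0 : ℝ), basis n m t * g t := by
    rw [← integral_const_mul, ← integral_add (hf.1 m) ((hg.1 m).const_mul c)]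
    congr 1
    funext t
    ring
  rw [seriesTerm, h, seriesTerm, seriesTerm]
  ring

theorem operator_add_mul {n : ℝ} {j : ℤ} {f g : ℝ → ℝ} {x : ℝ} (hf : OperatorDefined n j f x)
    (hg : OperatorDefined n j g x) (c : ℝ) :
    operator n j (fun t => f t + c * g t) x = operator n j f x + c * operator n j g x := by
  simp only [operator, seriesTerm_add_mul hf hg]
  rw [hf.2.tsum_add (hg.2.mul_left c), tsum_mul_left]
  ring

theorem add_mul_mem_expGrowth {A : ℝ} {f g : ℝ → ℝ} (hf : f ∈ expGrowth A) (hg : g ∈ expGrowth A)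
    (c : ℝ) : (fun t => f t + c * g t) ∈ expGrowth A := by
  obtain ⟨hf1, K, hK, hf2⟩ := hf
  obtain ⟨hg1, L, hL, hg2⟩ := hg
  refine ⟨hf1.add (hg1.smul c), K + |c| * L, by positivity, fun t ht => ?_⟩
  calc |f t + c * g t| ≤ |f t| + |c| * |g t| := by
        rw [← abs_mul]
        exact abs_add_le _ _
    _ ≤ K * Real.exp (A * t) + |c| * (L * Real.exp (A * t)) := by
        gcongr
        · exact hf2 t ht
        · exact hg2 t ht
    _ = _ := by ring

theorem expGrowth_mono {A B : ℝ} (h : A ≤ B) : expGrowth A ⊆ expGrowth B := by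
  rintro f ⟨hf1, K, hK, hf2⟩
  refine ⟨hf1, K, hK, fun t ht => (hf2 t ht).trans ?_⟩
  gcongr

theorem pow_mem_expGrowth {A : ℝ} (hA : 1 ≤ A) (r : ℕ) : (fun t : ℝ => t ^ r) ∈ expGrowth A := by
  refine expGrowth_mono hA ⟨(continuous_pow r).locallyIntegrable.locallyIntegrableOn _,
    r.factorial, by positivity, fun t ht => ?_⟩
  have h := Real.pow_div_factorial_le_exp t ht r
  rw [div_le_iff₀ (by positivity)] at h
  rw [abs_of_nonneg (pow_nonneg ht r), one_mul]
  linarith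

theorem zero_mem_expGrowth (A : ℝ) : (fun _ : ℝ => (0 : ℝ)) ∈ expGrowth A :=
  ⟨continuous_const.locallyIntegrable.locallyIntegrableOn _, 1, one_pos, fun t _ => by
    simpa using (Real.exp_pos _).le⟩

theorem sum_pow_mem_expGrowth {A : ℝ} (hA : 1 ≤ A) (a : ℕ → ℝ) (N : ℕ) :
    (fun t : ℝ => ∑ r ∈ Finset.range N, a r * t ^ r) ∈ expGrowth A := by
  induction N with
  | zero => simpa using zero_mem_expGrowth A
  | succ N ih =>
    simp only [Finset.sum_range_succ]
    exact add_mul_mem_expGrowth ih (pow_mem_expGrowth hA N) (a N)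

theorem operator_zero (n : ℝ) (j : ℤ) (x : ℝ) : operator n j (fun _ => 0) x = 0 := by
  simp [operator, seriesTerm]

theorem operator_sum_pow {n : ℝ} (hn : 1 < n) (j : ℤ) {x : ℝ} (hx : 0 ≤ x) (a : ℕ → ℝ) (N : ℕ) :
    operator n j (fun t : ℝ => ∑ r ∈ Finset.range N, a r * t ^ r) x =
      ∑ r ∈ Finset.range N, a r * operator n j (fun t => t ^ r) x := by
  have hn0 : 0 < n := one_pos.trans hn
  induction N with
  | zero => simpa using operator_zero n j x
  | succ N ih =>
    simp only [Finset.sum_range_succ]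
    rw [operator_add_mul
      (operatorDefined_of_mem_expGrowth (sum_pow_mem_expGrowth le_rfl a N) hn0 hn j hx)
      (operatorDefined_of_mem_expGrowth (pow_mem_expGrowth le_rfl N) hn0 hn j hx), ih]

/-- The moments of the operator. The sum over `i` comes from the Poisson factorial moments and
Vandermonde's identity; the terms with `0 ≤ k < j` are those by which the series for `k ≥ j` and
the value at `0` differ from a sum over all `k ≥ 0`. -/
theorem operator_pow {n : ℝ} (hn : 0 < n) (j : ℤ) (x : ℝ) (r : ℕ) :
    operator n j (fun t => t ^ r) x =
      ∑ i ∈ Finset.range (r + 1),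
        (r.choose i : ℝ) * (descPochhammer ℝ i).eval ((r : ℝ) - j) * (n * x) ^ (r - i) / n ^ r +
      ∑ k ∈ Finset.Ico 0 j,
        basis n k x * (0 ^ r - (descPochhammer ℝ r).eval ((k : ℝ) + (r - j)) / n ^ r) := by
  have h1 : HasSum (fun k : ℤ => basis n k x * (descPochhammer ℝ r).eval ((k : ℝ) + (r - j)))
      (∑ i ∈ Finset.range (r + 1),
        (r.choose i : ℝ) * (descPochhammer ℝ i).eval ((r : ℝ) - j) * (n * x) ^ (r - i)) := by
    have := hasSum_sum (s := Finset.range (r + 1)) fun i _ =>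
      (hasSum_basis_mul_descPochhammer n x (r - i)).mul_left
        ((r.choose i : ℝ) * (descPochhammer ℝ i).eval ((r : ℝ) - j))
    refine Eq.subst (motive := fun F => HasSum F _) (funext fun k => ?_) this
    rw [descPochhammer_eval_add, Finset.mul_sum]
    exact Finset.sum_congr rfl fun i _ => by ring
  have h2 := (hasSum_int_shift (fun k hk => by simp [basis_of_neg n hk]) h1 j).div_const (n ^ r)
  have h3 : ∀ m : ℕ, seriesTerm n j (fun t => t ^ r) x m = basis n (j + m) x *
      (descPochhammer ℝ r).eval (((j + m : ℤ) : ℝ) + (r - j)) / n ^ r := fun m => by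
    rw [seriesTerm, mul_integral_basis_mul_pow hn, mul_div_assoc]
    congr 3
    push_cast
    ring
  rw [operator, tsum_congr h3, h2.tsum_eq, sub_div, Finset.sum_div, Finset.mul_sum,
    Finset.sum_div, add_sub, add_comm, add_sub_assoc, ← Finset.sum_sub_distrib]
  congr 1
  exact Finset.sum_congr rfl fun k _ => by ring

/-! ### Pointwise derivatives and the differential operators -/

theorem DerivExists.of_le {f : ℝ → ℝ} {x : ℝ} {m k : ℕ} (h : DerivExists f m x) (hk : k ≤ m) :
    DerivExists f k x := by
  obtain ⟨d, rfl⟩ := Nat.exists_eq_add_of_le hk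
  clear hk
  induction d with
  | zero => exact h
  | succ d ih => exact ih (Eventually.self_of_nhds h.1)

theorem iteratedDeriv_iteratedDeriv (f : ℝ → ℝ) (i k : ℕ) :
    iteratedDeriv i (iteratedDeriv k f) = iteratedDeriv (k + i) f := by
  rw [iteratedDeriv_eq_iterate, iteratedDeriv_eq_iterate, iteratedDeriv_eq_iterate, add_comm,
    Function.iterate_add_apply]

theorem DerivExists.iteratedDeriv {f : ℝ → ℝ} {x : ℝ} {k m : ℕ} (h : DerivExists f (k + m) x) :
    DerivExists (iteratedDeriv k f) m x := by
  induction m generalizing x with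
  | zero => trivial
  | succ m ih =>
    refine ⟨h.1.mono fun t ht => ih ht, ?_⟩
    rw [iteratedDeriv_iteratedDeriv]
    exact h.2

theorem derivExists_of_contDiff {f : ℝ → ℝ} (hf : ContDiff ℝ ⊤ f) (m : ℕ) (x : ℝ) :
    DerivExists f m x := by
  induction m generalizing x with
  | zero => trivial
  | succ m ih =>
    exact ⟨Eventually.of_forall ih, (hf.differentiable_iteratedDeriv m (by simp)) x⟩

/-- Taylor's formula with Peano remainder, in the form that two functions whose derivatives at `x`
agree up to the order `m` differ by `o((t - x)^m)`. Only the pointwise existence of the `m`-th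
derivatives at `x` is needed: the mean value inequality passes from the derivatives to the
functions. -/
theorem sub_isLittleO_of_iteratedDeriv_eq {m : ℕ} (hm : 1 ≤ m) {f p : ℝ → ℝ} {x : ℝ}
    (hf : DerivExists f m x) (hp : DerivExists p m x)
    (h : ∀ i ≤ m, iteratedDeriv i f x = iteratedDeriv i p x) :
    (fun t => f t - p t) =o[𝓝 x] (fun t => (t - x) ^ m) := by
  induction m, hm using Nat.le_induction generalizing f p with
  | base =>
    have h0 : f x = p x := by simpa using h 0 (by simp)
    have h1 : deriv f x = deriv p x := by simpa using h 1 le_rfl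
    have hf' : DifferentiableAt ℝ f x := by simpa using hf.2
    have hp' : DifferentiableAt ℝ p x := by simpa using hp.2
    have hd := (hf'.hasDerivAt.sub hp'.hasDerivAt)
    rw [h1, sub_self, hasDerivAt_iff_isLittleO] at hd
    simpa [h0] using hd
  | succ m hm ih =>
    have hf' : DerivExists (deriv f) m x := by
      simpa using DerivExists.iteratedDeriv (k := 1) (by rwa [add_comm])
    have hp' : DerivExists (deriv p) m x := by
      simpa using DerivExists.iteratedDeriv (k := 1) (by rwa [add_comm])
    have ih' := ih hf' hp' fun i hi => by
      simpa [iteratedDeriv_succ'] using h (i + 1) (by omega)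
    have h0 : f x = p x := by simpa using h 0 (by simp)
    have hdf : ∀ᶠ t in 𝓝 x, DifferentiableAt ℝ f t :=
      hf.1.mono fun t ht => by simpa using (ht.of_le hm).2
    have hdp : ∀ᶠ t in 𝓝 x, DifferentiableAt ℝ p t :=
      hp.1.mono fun t ht => by simpa using (ht.of_le hm).2
    refine isLittleO_iff.2 fun c hc => ?_
    obtain ⟨δ, hδ, hball⟩ := Metric.eventually_nhds_iff_ball.1
      ((isLittleO_iff.1 ih' hc).and (hdf.and hdp))
    filter_upwards [Metric.ball_mem_nhds x hδ] with t ht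
    have hsub : Metric.closedBall x |t - x| ⊆ Metric.ball x δ :=
      Metric.closedBall_subset_ball (by simpa [Real.dist_eq] using ht)
    have key := (convex_closedBall x |t - x|).norm_image_sub_le_of_norm_hasDerivWithin_le
      (f := fun s => f s - p s) (f' := fun s => deriv f s - deriv p s) (C := c * |t - x| ^ m)
      (fun s hs => ((hball s (hsub hs)).2.1.hasDerivAt.sub
        (hball s (hsub hs)).2.2.hasDerivAt).hasDerivWithinAt)
      (fun s hs => by
        refine ((hball s (hsub hs)).1).trans ?_
        rw [norm_pow, Real.norm_eq_abs]
        have : |s - x| ≤ |t - x| := by simpa [Real.dist_eq] using hs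
        gcongr)
      (x := x) (y := t) (by simp) (by simp [Real.dist_eq])
    simp only [h0, sub_self, sub_zero] at key
    rw [norm_pow, pow_succ, ← mul_assoc]
    exact key

/-- For a factor that is analytic on `(0, ∞)`, the `m`-th derivative of a product depends linearly
on the derivatives of the other factor at the same point, as soon as these exist there. The
coefficients are those of Leibniz' formula, but their values do not matter. -/
theorem exists_iteratedDeriv_mul_eq {a : ℝ → ℝ} (ha : ContDiffOn ℝ ⊤ a (Set.Ioi 0)) (m : ℕ) :
    ∃ c : ℕ → ℝ → ℝ, (∀ i, ContDiffOn ℝ ⊤ (c i) (Set.Ioi 0)) ∧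
      ∀ (g : ℝ → ℝ) (t : ℝ), 0 < t → DerivExists g m t →
        iteratedDeriv m (fun s => a s * g s) t =
          ∑ i ∈ Finset.range (m + 1), c i t * iteratedDeriv i g t := by
  induction m with
  | zero => exact ⟨fun _ => a, fun _ => ha, fun g t _ _ => by simp⟩
  | succ m ih =>
    obtain ⟨c, hc, h⟩ := ih
    have hc' : ∀ i, ContDiffOn ℝ ⊤ (deriv (c i)) (Set.Ioi 0) := fun i =>
      (hc i).deriv_of_isOpen isOpen_Ioi (by simp)
    refine ⟨fun i t => (if i ≤ m then deriv (c i) t else 0) + (if i = 0 then 0 else c (i - 1) t),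
      fun i => ?_, fun g t ht hg => ?_⟩
    · refine ContDiffOn.add ?_ ?_
      · split_ifs
        · exact hc' i
        · exact contDiffOn_const
      · split_ifs
        · exact contDiffOn_const
        · exact hc _
    · have hev : iteratedDeriv m (fun s => a s * g s) =ᶠ[𝓝 t]
          fun s => ∑ i ∈ Finset.range (m + 1), c i s * iteratedDeriv i g s := by
        filter_upwards [hg.1, lt_mem_nhds ht] with s hs hs0 using h g s hs0 hs
      rw [iteratedDeriv_succ, hev.deriv_eq]
      have hd : HasDerivAt (fun s => ∑ i ∈ Finset.range (m + 1), c i s * iteratedDeriv i g s)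
          (∑ i ∈ Finset.range (m + 1),
            (deriv (c i) t * iteratedDeriv i g t + c i t * iteratedDeriv (i + 1) g t)) t := by
        refine HasDerivAt.fun_sum fun i hi => ?_
        have h1 : DifferentiableAt ℝ (c i) t :=
          ((hc i).differentiableOn (by simp)).differentiableAt (Ioi_mem_nhds ht)
        have h2 : DifferentiableAt ℝ (iteratedDeriv i g) t :=
          (hg.of_le (k := i + 1) (by simpa using hi)).2
        rw [iteratedDeriv_succ]
        exact h1.hasDerivAt.mul h2.hasDerivAt
      rw [hd.deriv, Finset.sum_add_distrib]
      simp only [add_mul, Finset.sum_add_distrib]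
      congr 1
      · rw [Finset.sum_range_succ _ (m + 1)]
        simp only [show ¬ (m + 1 ≤ m) by omega, if_false, zero_mul, add_zero]
        exact Finset.sum_congr rfl fun i hi => by
          rw [if_pos (by simpa [Nat.lt_succ_iff] using hi)]
      · rw [Finset.sum_range_succ' _ (m + 1)]
        simp

theorem contDiffOn_zpow (z : ℤ) : ContDiffOn ℝ ⊤ (fun t : ℝ => t ^ z) (Set.Ioi 0) := by
  intro t ht
  have ht : t ≠ 0 := (ne_of_gt ht)
  refine ContDiffAt.contDiffWithinAt ?_
  cases z with
  | ofNat k => simpa using contDiffAt_id.pow k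
  | negSucc k =>
    simp only [zpow_negSucc]
    exact (contDiffAt_id.pow (k + 1)).inv (pow_ne_zero _ ht)

/-- The operator `𝒟_j^{2k}` at a positive point is a linear combination of derivatives. -/
theorem exists_diffOp_eq (j : ℤ) (k : ℕ) {x : ℝ} (hx : 0 < x) :
    ∃ c : ℕ → ℝ, ∀ f : ℝ → ℝ, DerivExists f (2 * k) x →
      diffOp j k f x = ∑ i ∈ Finset.range (k + 1), c i * iteratedDeriv (k + i) f x := by
  obtain ⟨c, -, h⟩ := exists_iteratedDeriv_mul_eq (contDiffOn_zpow ((k : ℤ) - j)) k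
  refine ⟨fun i => x ^ j * c i x, fun f hf => ?_⟩
  rw [two_mul] at hf
  rw [diffOp, h _ x hx hf.iteratedDeriv, Finset.mul_sum]
  exact Finset.sum_congr rfl fun i _ => by rw [iteratedDeriv_iteratedDeriv, mul_assoc]

/-- Evaluation of `𝒟_j^{2k}` on monomials. -/
theorem diffOp_pow (j : ℤ) (k r : ℕ) {x : ℝ} (hx : 0 < x) :
    diffOp j k (fun t => t ^ r) x =
      (r.descFactorial k : ℝ) * (descPochhammer ℝ k).eval ((r : ℝ) - j) * x ^ (r - k) := by
  have h1 : iteratedDeriv k (fun t : ℝ => t ^ r) =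
      fun t => (r.descFactorial k : ℝ) * t ^ (r - k) := by
    funext t
    simp [← descPochhammer_eval_eq_descFactorial, descPochhammer_eval_eq_prod_range]
  by_cases hkr : k ≤ r
  swap
  · have h0 : r.descFactorial k = 0 := Nat.descFactorial_of_lt (not_le.1 hkr)
    simp [diffOp, h0]
  have h2 : (fun t : ℝ => t ^ ((k : ℤ) - j) * iteratedDeriv k (fun t : ℝ => t ^ r) t) =ᶠ[𝓝 x]
      fun t => (r.descFactorial k : ℝ) * t ^ ((r : ℤ) - j) := by
    filter_upwards [lt_mem_nhds hx] with t ht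
    have : t ^ ((r : ℤ) - j) = t ^ ((k : ℤ) - j) * t ^ (r - k) := by
      rw [← zpow_natCast, ← zpow_add₀ ht.ne']
      congr 1
      omega
    rw [h1, this]
    ring
  have h3 : x ^ (r - k) = x ^ j * x ^ ((r : ℤ) - j - k) := by
    rw [← zpow_natCast, ← zpow_add₀ hx.ne']
    congr 1
    omega
  rw [diffOp, h2.iteratedDeriv_eq, h3, iteratedDeriv_const_mul_field, iteratedDeriv_eq_iterate,
    iter_deriv_zpow, descPochhammer_eval_eq_prod_range]
  push_cast
  ring

/-- The Taylor polynomial, written in powers of `t` rather than of `t - x`. -/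
theorem exists_sum_pow_iteratedDeriv_eq (b : ℕ → ℝ) (x : ℝ) (N : ℕ) :
    ∃ a : ℕ → ℝ, ∀ i ≤ N,
      iteratedDeriv i (fun t => ∑ r ∈ Finset.range (N + 1), a r * t ^ r) x = b i := by
  let Q : Polynomial ℝ := ∑ i ∈ Finset.range (N + 1), Polynomial.monomial i (b i / i.factorial)
  have hQd : Q.natDegree ≤ N := Polynomial.natDegree_sum_le_of_forall_le _ _ fun i hi =>
    (Polynomial.natDegree_monomial_le _).trans (by simpa [Nat.lt_succ_iff] using hi)
  let p := Polynomial.taylor (-x) Q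
  have hpd : p.natDegree < N + 1 := by
    rw [Polynomial.natDegree_taylor]
    omega
  refine ⟨p.coeff, fun i hi => ?_⟩
  have h1 : (fun t => ∑ r ∈ Finset.range (N + 1), p.coeff r * t ^ r) = fun t => p.eval t :=
    funext fun t => (Polynomial.eval_eq_sum_range' hpd t).symm
  have h2 : ∀ (i : ℕ) (P : Polynomial ℝ), iteratedDeriv i (fun t => P.eval t) =
      fun t => (Polynomial.derivative^[i] P).eval t := by
    intro i
    induction i with
    | zero => simp
    | succ i ih =>
      intro P
      rw [iteratedDeriv_succ', Function.iterate_succ_apply, ← ih]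
      congr 1
      funext t
      exact Polynomial.deriv P
  have h3 : Polynomial.taylor x p = Q := by
    rw [Polynomial.taylor_taylor]
    simp
  have h4 : Q.coeff i = b i / i.factorial := by
    simp [Q, Polynomial.coeff_monomial, hi]
  rw [h1, h2]
  rw [← h3, Polynomial.taylor_coeff] at h4
  rw [← Polynomial.factorial_smul_hasseDeriv]
  simp only [LinearMap.smul_apply, Polynomial.eval_smul, h4]
  have : (i.factorial : ℝ) ≠ 0 := by positivity
  simp only [nsmul_eq_mul]
  field_simp

/-! ### Asymptotics -/

theorem isLittleO_one_div_pow {u : ℕ → ℝ} {q : ℕ}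
    (h : Tendsto (fun n : ℕ => (n : ℝ) ^ q * u n) atTop (𝓝 0)) :
    u =o[atTop] (fun n : ℕ => 1 / (n : ℝ) ^ q) := by
  refine (isLittleO_iff_tendsto' ?_).2 ?_
  · filter_upwards [eventually_gt_atTop 0] with n hn h0
    have : (0 : ℝ) < n := by exact_mod_cast hn
    exact absurd h0 (by positivity)
  · refine h.congr fun n => ?_
    rw [div_div_eq_mul_div, div_one, mul_comm]

theorem tendsto_pow_mul_exp_neg_mul (q : ℕ) {b : ℝ} (hb : 0 < b) :
    Tendsto (fun y : ℝ => y ^ q * Real.exp (-(b * y))) atTop (𝓝 0) := by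
  have h := ((Real.tendsto_pow_mul_exp_neg_atTop_nhds_zero q).comp
    (tendsto_id.const_mul_atTop hb)).const_mul ((b ^ q)⁻¹)
  rw [mul_zero] at h
  refine h.congr fun y => ?_
  simp only [Function.comp, id, mul_pow]
  field_simp

/-- For fixed `k` and `x > 0` the basis functions decay exponentially in `n`. This is why the value
`f 0` does not enter the expansion. -/
theorem basis_isLittleO {x : ℝ} (hx : 0 < x) (k : ℤ) (q : ℕ) :
    (fun n : ℕ => basis n k x) =o[atTop] (fun n : ℕ => 1 / (n : ℝ) ^ q) := by
  rcases lt_or_ge k 0 with hk | hk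
  · simp only [basis_of_neg _ hk]
    exact isLittleO_zero _ _
  · lift k to ℕ using hk
    refine isLittleO_one_div_pow ?_
    have h := (((tendsto_pow_mul_exp_neg_mul (q + k) hx).comp
      tendsto_natCast_atTop_atTop).const_mul (x ^ k / k.factorial))
    rw [mul_zero] at h
    refine h.congr fun n => ?_
    simp only [Function.comp, basis_natCast]
    rw [mul_comm (n : ℝ) x, mul_pow, pow_add]
    ring

/-- Applying the integral part of the operator to `t ↦ e^{ε √n (t - x)}` gives at most the
expression below (by `abs_tsum_seriesTerm_le`); hence these exponential moments stay bounded. -/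
theorem tendsto_exp_moment_bound (j : ℤ) (x ε : ℝ) :
    Tendsto (fun n : ℕ => Real.exp (-(ε * √n * x)) *
      (((n : ℝ) / (n - ε * √n)) ^ (1 - j) *
        Real.exp (n * x * ((n : ℝ) / (n - ε * √n) - 1)))) atTop (𝓝 (Real.exp (ε ^ 2 * x))) := by
  have hs : Tendsto (fun n : ℕ => √(n : ℝ)) atTop atTop :=
    Real.tendsto_sqrt_atTop.comp tendsto_natCast_atTop_atTop
  have h1 : Tendsto (fun s : ℝ => s / (s - ε)) atTop (𝓝 1) := by
    have : Tendsto (fun s : ℝ => (1 - ε * s⁻¹)⁻¹) atTop (𝓝 (1 - ε * 0)⁻¹) :=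
      (tendsto_const_nhds.sub (tendsto_inv_atTop_zero.const_mul ε)).inv₀ (by simp)
    simp only [mul_zero, sub_zero, inv_one] at this
    refine this.congr' ?_
    filter_upwards [eventually_gt_atTop 0] with s hs
    rw [← inv_div]
    congr 1
    field_simp
  have h2 : Tendsto (fun s : ℝ => (s / (s - ε)) ^ (1 - j) * Real.exp (ε ^ 2 * x * (s / (s - ε))))
      atTop (𝓝 (1 ^ (1 - j) * Real.exp (ε ^ 2 * x * 1))) :=
    (h1.zpow₀ _ (Or.inl one_ne_zero)).mul
      (Real.continuous_exp.continuousAt.tendsto.comp (h1.const_mul _))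
  rw [one_zpow, one_mul, mul_one] at h2
  refine (h2.comp hs).congr' ?_
  filter_upwards [hs.eventually_gt_atTop 0, hs.eventually_gt_atTop ε] with n hn0 hnε
  simp only [Function.comp]
  have hsq : (n : ℝ) = √(n : ℝ) * √(n : ℝ) := (Real.mul_self_sqrt n.cast_nonneg).symm
  have hne : √(n : ℝ) - ε ≠ 0 := (sub_pos.2 hnε).ne'
  have hr : (n : ℝ) / (n - ε * √n) = √n / (√n - ε) := by
    generalize √(n : ℝ) = s at *
    rw [hsq, ← sub_mul, mul_div_mul_right _ _ hn0.ne']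
  rw [hr, mul_left_comm, ← Real.exp_add]
  congr 2
  generalize √(n : ℝ) = s at *
  rw [hsq]
  field_simp
  ring

theorem exp_mul_abs_le (s u : ℝ) :
    Real.exp (s * |u|) ≤ Real.exp (s * u) + Real.exp (-(s * u)) := by
  rcases abs_choice u with h | h <;> rw [h]
  · linarith [Real.exp_pos (-(s * u))]
  · rw [mul_neg]
    linarith [Real.exp_pos (s * u)]

/-- A function that is `O((t - x)^{2q})` with a small constant near `x` and has exponential growth
is dominated by a small multiple of the two exponentials `e^{± s (t - x)}`. With `s = √n` the first
summand in the factor is of order `n^{-q}` and the second one decays faster than every power. -/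
theorem abs_le_exp_add_exp {A K ε δ x s : ℝ} {q : ℕ} {g : ℝ → ℝ} (hs : 0 < s) (hA : 0 ≤ A)
    (hAs : A ≤ s) (hε : 0 ≤ ε) (hK : 0 ≤ K)
    (hnear : ∀ t, |t - x| < δ → |g t| ≤ ε * |t - x| ^ (2 * q))
    (hfar : ∀ t, 0 ≤ t → |g t| ≤ K * Real.exp (A * t)) {t : ℝ} (ht : 0 ≤ t) :
    |g t| ≤ (ε * (2 * q).factorial / s ^ (2 * q) +
        K * Real.exp (A * x + A * δ) * Real.exp (-(δ * s))) *
      (Real.exp (s * (t - x)) + Real.exp (-(s * (t - x)))) := by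
  set M₁ := ε * (2 * q).factorial / s ^ (2 * q)
  set M₂ := K * Real.exp (A * x + A * δ) * Real.exp (-(δ * s))
  have hM₁ : 0 ≤ M₁ := by positivity
  have hM₂ : 0 ≤ M₂ := by positivity
  refine le_trans ?_ (mul_le_mul_of_nonneg_left (exp_mul_abs_le s (t - x)) (add_nonneg hM₁ hM₂))
  rcases lt_or_ge |t - x| δ with h | h
  · have h1 := Real.pow_div_factorial_le_exp (s * |t - x|) (by positivity) (2 * q)
    calc |g t| ≤ ε * |t - x| ^ (2 * q) := hnear t h
      _ = M₁ * ((s * |t - x|) ^ (2 * q) / (2 * q).factorial) := by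
        have : ((2 * q).factorial : ℝ) ≠ 0 := by positivity
        simp only [M₁, mul_pow]
        field_simp
      _ ≤ M₁ * Real.exp (s * |t - x|) := mul_le_mul_of_nonneg_left h1 hM₁
      _ ≤ _ := mul_le_mul_of_nonneg_right (le_add_of_nonneg_right hM₂) (Real.exp_pos _).le
  · calc |g t| ≤ K * Real.exp (A * t) := hfar t ht
      _ ≤ K * Real.exp (A * x + A * δ + -(δ * s) + s * |t - x|) := by
        gcongr
        have h1 : A * t ≤ A * x + A * |t - x| := by
          rw [← mul_add]
          exact mul_le_mul_of_nonneg_left (by linarith [le_abs_self (t - x)]) hA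
        nlinarith [mul_nonneg (sub_nonneg.2 hAs) (sub_nonneg.2 h)]
      _ = M₂ * Real.exp (s * |t - x|) := by
        simp only [M₂, Real.exp_add]
        ring
      _ ≤ _ := mul_le_mul_of_nonneg_right (le_add_of_nonneg_left hM₁) (Real.exp_pos _).le

/-- Localization: the operator does not see a remainder that is `o((t - x)^{2q})` up to
`o(n^{-q})`. -/
theorem tsum_seriesTerm_isLittleO (j : ℤ) {q : ℕ} {x : ℝ} (hx : 0 < x) {A : ℝ} (hA : 0 ≤ A)
    {g : ℝ → ℝ} (hg : g ∈ expGrowth A) (ho : g =o[𝓝 x] (fun t => (t - x) ^ (2 * q))) :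
    (fun n : ℕ => ∑' m, seriesTerm n j g x m) =o[atTop] (fun n : ℕ => 1 / (n : ℝ) ^ q) := by
  obtain ⟨-, K, hK, hfar⟩ := hg
  have hs : Tendsto (fun n : ℕ => √(n : ℝ)) atTop atTop :=
    Real.tendsto_sqrt_atTop.comp tendsto_natCast_atTop_atTop
  refine isLittleO_iff.2 fun c hc => ?_
  set B := Real.exp x + 1 with hB
  have hB0 : 0 < B := by positivity
  have hF : (0 : ℝ) < (2 * q).factorial := by positivity
  -- The two exponentials contribute at most `2 B` in total, and `ε (2q)!` becomes `c / (4 B)`.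
  set ε := c / (4 * B * (2 * q).factorial) with hε
  have hε0 : 0 < ε := by positivity
  obtain ⟨δ, hδ, hball⟩ := Metric.eventually_nhds_iff_ball.1 (isLittleO_iff.1 ho hε0)
  have hnear : ∀ t, |t - x| < δ → |g t| ≤ ε * |t - x| ^ (2 * q) := fun t ht => by
    have := hball t (by simpa [Real.dist_eq] using ht)
    rwa [norm_pow, Real.norm_eq_abs, Real.norm_eq_abs] at this
  -- Away from `x`: the contribution of the exponential growth, scaled by `n^q`.
  have hsmall : ∀ᶠ n : ℕ in atTop, K * Real.exp (A * x + A * δ) *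
      (√(n : ℝ) ^ (2 * q) * Real.exp (-(δ * √n))) < c / (4 * B) := by
    have h := ((tendsto_pow_mul_exp_neg_mul (2 * q) hδ).comp hs).const_mul
      (K * Real.exp (A * x + A * δ))
    rw [mul_zero] at h
    exact h.eventually_lt_const (by positivity)
  have hm : ∀ e : ℝ, e ^ 2 = 1 → ∀ᶠ n : ℕ in atTop, Real.exp (-(e * √n * x)) *
      (((n : ℝ) / (n - e * √n)) ^ (1 - j) *
        Real.exp (n * x * ((n : ℝ) / (n - e * √n) - 1))) < B := fun e he =>
    (tendsto_exp_moment_bound j x e).eventually_lt_const (by rw [he, one_mul, hB]; linarith)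
  filter_upwards [hs.eventually_gt_atTop 1, hs.eventually_ge_atTop A, hsmall, hm 1 (by norm_num),
    hm (-1) (by norm_num)] with n hn1 hnA hns hp hmi
  have hsq : (n : ℝ) = √(n : ℝ) ^ 2 := (Real.sq_sqrt n.cast_nonneg).symm
  have hs0 : 0 < √(n : ℝ) := by linarith
  have hn0 : (0 : ℝ) < n := by rw [hsq]; positivity
  have ha : 1 * √(n : ℝ) < n := by nlinarith
  have hb : -1 * √(n : ℝ) < n := by linarith
  set M := ε * (2 * q).factorial / √(n : ℝ) ^ (2 * q) +
    K * Real.exp (A * x + A * δ) * Real.exp (-(δ * √n)) with hM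
  have hM0 : 0 ≤ M := by positivity
  have hgle : ∀ t > 0, |g t| ≤ M * Real.exp (-(1 * √n * x)) * Real.exp (1 * √n * t) +
      M * Real.exp (-(-1 * √n * x)) * Real.exp (-1 * √n * t) := fun t ht => by
    refine (abs_le_exp_add_exp hs0 hA hnA hε0.le hK.le hnear hfar (le_of_lt ht)).trans
      (le_of_eq ?_)
    rw [← hM, mul_add, mul_assoc M, mul_assoc M, ← Real.exp_add, ← Real.exp_add]
    ring_nf
  have hT := abs_tsum_seriesTerm_le hn0 ha hb (by positivity) (by positivity) hgle j hx.le
  rw [mul_assoc M, mul_assoc M] at hT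
  have hT2 : |∑' m, seriesTerm n j g x m| ≤ M * B + M * B := hT.trans (by gcongr)
  have hMle : M * √(n : ℝ) ^ (2 * q) ≤ c / (2 * B) := by
    have e1 : M * √(n : ℝ) ^ (2 * q) = ε * (2 * q).factorial + K * Real.exp (A * x + A * δ) *
      (√(n : ℝ) ^ (2 * q) * Real.exp (-(δ * √n))) := by
      rw [hM]
      field_simp
    have e2 : ε * (2 * q).factorial = c / (4 * B) := by
      rw [hε]
      field_simp
    have e3 : c / (2 * B) = c / (4 * B) + c / (4 * B) := by
      field_simp
      norm_num
    rw [e1, e2, e3]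
    linarith
  have hpow : √(n : ℝ) ^ (2 * q) = (n : ℝ) ^ q := by rw [pow_mul, ← hsq]
  rw [hpow] at hMle
  have hnq : (0 : ℝ) < (n : ℝ) ^ q := by positivity
  rw [Real.norm_eq_abs, Real.norm_of_nonneg (by positivity), mul_one_div, le_div_iff₀ hnq]
  calc _ ≤ (M * B + M * B) * (n : ℝ) ^ q := by gcongr
    _ = M * (n : ℝ) ^ q * (2 * B) := by ring
    _ ≤ c / (2 * B) * (2 * B) := by gcongr
    _ = c := by field_simp

/-- Truncating a polynomial in `1/n` of degree at most `r` after the order `q` costs `o(n^{-q})`;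
this covers both `r ≤ q`, where nothing is lost, and `q < r`. -/
theorem sum_range_sub_sum_range_isLittleO {b : ℕ → ℝ} {r : ℕ} (hb : ∀ i, r < i → b i = 0)
    (q : ℕ) :
    (fun n : ℕ => ∑ i ∈ Finset.range (r + 1), b i / (n : ℝ) ^ i -
      ∑ i ∈ Finset.range (q + 1), b i / (n : ℝ) ^ i) =o[atTop] (fun n : ℕ => 1 / (n : ℝ) ^ q) := by
  rcases le_total r q with h | h
  · refine (isLittleO_zero _ _).congr_left fun n => ?_
    rw [eq_comm, sub_eq_zero]
    refine Finset.sum_subset (Finset.range_subset_range.2 (by omega)) fun i _ hi => ?_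
    rw [hb i (by simpa using hi), zero_div]
  · simp only [← Finset.sum_Ico_eq_sub _ (Nat.succ_le_succ h)]
    refine IsLittleO.fun_sum fun i hi => isLittleO_one_div_pow ?_
    obtain ⟨d, hd⟩ := Nat.exists_eq_add_of_le (Finset.mem_Ico.1 hi).1
    have h0 : Tendsto (fun n : ℕ => b i * ((n : ℝ) ^ (d + 1))⁻¹) atTop (𝓝 (b i * 0)) :=
      (((tendsto_pow_atTop (by omega)).comp
        tendsto_natCast_atTop_atTop).inv_tendsto_atTop).const_mul _
    rw [mul_zero] at h0
    refine h0.congr' ?_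
    filter_upwards [eventually_gt_atTop 0] with n hn
    have : (0 : ℝ) < n := by exact_mod_cast hn
    rw [hd, Nat.succ_eq_add_one]
    field_simp
    ring

/-- The asymptotic expansion for monomials. -/
theorem operator_pow_sub_isLittleO (j : ℤ) (q r : ℕ) {x : ℝ} (hx : 0 < x) :
    (fun n : ℕ => operator n j (fun t => t ^ r) x - ∑ k ∈ Finset.range (q + 1),
        1 / ((k.factorial : ℝ) * (n : ℝ) ^ k) * diffOp j k (fun t => t ^ r) x)
      =o[atTop] (fun n : ℕ => 1 / (n : ℝ) ^ q) := by
  set b : ℕ → ℝ := fun i =>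
    (r.choose i : ℝ) * (descPochhammer ℝ i).eval ((r : ℝ) - j) * x ^ (r - i)
  have h1 := sum_range_sub_sum_range_isLittleO (b := b) (r := r)
    (fun i hi => by simp [b, Nat.choose_eq_zero_of_lt hi]) q
  have h2 : (fun n : ℕ => ∑ k ∈ Finset.Ico 0 j, basis n k x *
      (0 ^ r - (descPochhammer ℝ r).eval ((k : ℝ) + (r - j)) / (n : ℝ) ^ r))
      =o[atTop] (fun n : ℕ => 1 / (n : ℝ) ^ q) := by
    refine IsLittleO.fun_sum fun k _ => ?_
    have hO : (fun n : ℕ => (0 : ℝ) ^ r -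
        (descPochhammer ℝ r).eval ((k : ℝ) + (r - j)) / (n : ℝ) ^ r)
        =O[atTop] (fun _ : ℕ => (1 : ℝ)) := by
      refine IsBigO.of_bound (‖(0 : ℝ) ^ r‖ +
        ‖(descPochhammer ℝ r).eval ((k : ℝ) + (r - j))‖) ?_
      filter_upwards [eventually_ge_atTop 1] with n hn
      have hn' : (1 : ℝ) ≤ n := by exact_mod_cast hn
      rw [norm_one, mul_one]
      refine (norm_sub_le _ _).trans (add_le_add le_rfl ?_)
      rw [norm_div]
      refine div_le_self (norm_nonneg _) ?_
      rw [norm_pow, Real.norm_of_nonneg (by linarith)]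
      exact one_le_pow₀ hn'
    simpa using (basis_isLittleO hx k q).mul_isBigO hO
  refine (h1.add h2).congr' ?_ EventuallyEq.rfl
  filter_upwards [eventually_gt_atTop 0] with n hn
  have hn0 : (0 : ℝ) < n := by exact_mod_cast hn
  rw [operator_pow hn0, sub_add_eq_add_sub]
  congr 1
  · congr 1
    refine Finset.sum_congr rfl fun i hi => ?_
    have hi' : i ≤ r := by simpa [Nat.lt_succ_iff] using hi
    have : (n : ℝ) ^ r = (n : ℝ) ^ (r - i) * (n : ℝ) ^ i := by
      rw [← pow_add, Nat.sub_add_cancel hi']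
    rw [this, mul_pow]
    simp only [b]
    field_simp
  · refine Finset.sum_congr rfl fun k _ => ?_
    rw [diffOp_pow j k r hx, Nat.descFactorial_eq_factorial_mul_choose]
    have : (k.factorial : ℝ) ≠ 0 := by positivity
    simp only [b]
    push_cast
    field_simp

theorem diffOp_zero_eq (j : ℤ) (f : ℝ → ℝ) {x : ℝ} (hx : 0 < x) : diffOp j 0 f x = f x := by
  simp only [diffOp, iteratedDeriv_zero, Nat.cast_zero, zero_sub]
  rw [← mul_assoc, ← zpow_add₀ hx.ne', add_neg_cancel, zpow_zero, one_mul]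

theorem diffOp_sum_pow (j : ℤ) (k : ℕ) {x : ℝ} (hx : 0 < x) (a : ℕ → ℝ) (N : ℕ) :
    diffOp j k (fun t => ∑ r ∈ Finset.range N, a r * t ^ r) x =
      ∑ r ∈ Finset.range N, a r * diffOp j k (fun t => t ^ r) x := by
  obtain ⟨c, hc⟩ := exists_diffOp_eq j k hx
  have h : ∀ i, iteratedDeriv i (fun t => ∑ r ∈ Finset.range N, a r * t ^ r) x =
      ∑ r ∈ Finset.range N, a r * iteratedDeriv i (fun t => t ^ r) x := fun i => by
    rw [iteratedDeriv_fun_sum fun r _ => by fun_prop]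
    exact Finset.sum_congr rfl fun r _ => by rw [iteratedDeriv_const_mul_field]
  rw [hc _ (derivExists_of_contDiff (by fun_prop) _ _)]
  simp only [h, Finset.mul_sum]
  rw [Finset.sum_comm]
  refine Finset.sum_congr rfl fun r _ => ?_
  rw [hc _ (derivExists_of_contDiff (by fun_prop) _ _), Finset.mul_sum]
  exact Finset.sum_congr rfl fun i _ => by ring

end SzaszDurrmeyer

theorem mainTheorem1 (j : ℤ) (q : ℕ) (hq : 1 ≤ q) (f : ℝ → ℝ)
    (hf : f ∈ SzaszDurrmeyer.expGrowthSpace) (x : ℝ) (hx : 0 < x)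
    (hd : SzaszDurrmeyer.DerivExists f (2 * q) x) :
    (∀ A : ℝ, 0 ≤ A → f ∈ SzaszDurrmeyer.expGrowth A →
      ∀ n : ℕ, A < n → SzaszDurrmeyer.OperatorDefined n j f x) ∧
    (fun n : ℕ => SzaszDurrmeyer.operator n j f x -
        (f x + ∑ k ∈ Finset.Icc 1 q,
          1 / ((k.factorial : ℝ) * (n : ℝ) ^ k) * SzaszDurrmeyer.diffOp j k f x))
      =o[atTop] (fun n : ℕ => 1 / (n : ℝ) ^ q) := by
  open SzaszDurrmeyer in
  refine ⟨fun A hA hfA n hn =>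
    operatorDefined_of_mem_expGrowth hfA (hA.trans_lt hn) hn j hx.le, ?_⟩
  obtain ⟨A₀, hA₀, hfA₀⟩ := hf
  -- Powers of `t` have exponential growth of order `1`.
  set A := max A₀ 1
  have hA1 : 1 ≤ A := le_max_right _ _
  have hfA : f ∈ expGrowth A := expGrowth_mono (le_max_left _ _) hfA₀
  obtain ⟨a, ha⟩ := exists_sum_pow_iteratedDeriv_eq (fun i => iteratedDeriv i f x) x (2 * q)
  set p : ℝ → ℝ := fun t => ∑ r ∈ Finset.range (2 * q + 1), a r * t ^ r with hp
  have hpA : p ∈ expGrowth A := sum_pow_mem_expGrowth hA1 a _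
  have hpd : DerivExists p (2 * q) x :=
    derivExists_of_contDiff (by rw [hp]; fun_prop) _ _
  have hg : (fun t => f t + -1 * p t) ∈ expGrowth A := add_mul_mem_expGrowth hfA hpA (-1)
  have ho : (fun t => f t + -1 * p t) =o[𝓝 x] (fun t => (t - x) ^ (2 * q)) :=
    (sub_isLittleO_of_iteratedDeriv_eq (by omega) hd hpd fun i hi => (ha i hi).symm).congr_left
      fun t => by ring
  have hdiff : ∀ k ≤ q, diffOp j k f x = diffOp j k p x := fun k hk => by
    obtain ⟨c, hc⟩ := exists_diffOp_eq j k hx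
    rw [hc f (hd.of_le (by omega)), hc p (hpd.of_le (by omega))]
    refine Finset.sum_congr rfl fun i hi => ?_
    have : i ≤ k := by simpa [Nat.lt_succ_iff] using hi
    rw [ha (k + i) (by omega)]
  have h1 := tsum_seriesTerm_isLittleO j hx (by linarith) hg ho
  have h2 : (fun n : ℕ => (f 0 + -1 * p 0) * ∑ k ∈ Finset.Ico 0 j, basis n k x)
      =o[atTop] (fun n : ℕ => 1 / (n : ℝ) ^ q) :=
    (IsLittleO.fun_sum fun k _ => basis_isLittleO hx k q).const_mul_left _
  have h3 : (fun n : ℕ => ∑ r ∈ Finset.range (2 * q + 1),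
      a r * (operator n j (fun t => t ^ r) x - ∑ k ∈ Finset.range (q + 1),
        1 / ((k.factorial : ℝ) * (n : ℝ) ^ k) * diffOp j k (fun t => t ^ r) x))
      =o[atTop] (fun n : ℕ => 1 / (n : ℝ) ^ q) :=
    IsLittleO.fun_sum fun r _ => (operator_pow_sub_isLittleO j q r hx).const_mul_left _
  refine (h3.add (h2.add h1)).congr' ?_ EventuallyEq.rfl
  filter_upwards [tendsto_natCast_atTop_atTop.eventually_gt_atTop A] with n hn
  have hn0 : (0 : ℝ) < n := by linarith
  have e1 := operator_add_mul (operatorDefined_of_mem_expGrowth hfA hn0 hn j hx.le)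
    (operatorDefined_of_mem_expGrowth hpA hn0 hn j hx.le) (-1)
  have e2 : operator n j p x = ∑ r ∈ Finset.range (2 * q + 1),
      a r * operator n j (fun t => t ^ r) x :=
    operator_sum_pow (by linarith) j hx.le a _
  have e3 : f x + ∑ k ∈ Finset.Icc 1 q,
      1 / ((k.factorial : ℝ) * (n : ℝ) ^ k) * diffOp j k f x =
      ∑ r ∈ Finset.range (2 * q + 1), a r * ∑ k ∈ Finset.range (q + 1),
        1 / ((k.factorial : ℝ) * (n : ℝ) ^ k) * diffOp j k (fun t => t ^ r) x := by
    have e4 : f x + ∑ k ∈ Finset.Icc 1 q,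
        1 / ((k.factorial : ℝ) * (n : ℝ) ^ k) * diffOp j k f x =
        ∑ k ∈ Finset.range (q + 1), 1 / ((k.factorial : ℝ) * (n : ℝ) ^ k) * diffOp j k f x := by
      rw [Finset.sum_range_eq_add_Ico _ (by omega), diffOp_zero_eq j f hx,
        show Finset.Ico 1 (q + 1) = Finset.Icc 1 q from rfl]
      simp
    simp only [e4, Finset.mul_sum]
    rw [Finset.sum_comm]
    refine Finset.sum_congr rfl fun k hk => ?_
    rw [hdiff k (by simpa [Nat.lt_succ_iff] using hk), hp, diffOp_sum_pow j k hx, Finset.mul_sum]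
    exact Finset.sum_congr rfl fun r _ => by ring
  rw [e3]
  simp only [mul_sub, Finset.sum_sub_distrib]
  rw [← e2]
  have e5 : (f 0 + -1 * p 0) * ∑ k ∈ Finset.Ico 0 j, basis n k x +
      ∑' m, seriesTerm n j (fun t => f t + -1 * p t) x m =
      operator n j f x + -1 * operator n j p x := e1
  rw [e5]
  ring
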